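/- Conventions. Balls in $\mathbb{R}^d$ are closed and Euclidean; $B(c,r)$ has center $c$ and radius $r$, $r(B)$ is the radius of $B$, and the $a$-expansion of $B=B(c,r)$ is $aB=B(c,ar)$. For a nonempty bounded set $X\subset\mathbb{R}^d$, $\mathsf{MEB}(X)$ is the (unique) ball of minimum radius containing $X$. A ball $B$ is an $\alpha$-$\mathsf{MEB}(X)$ if $X\subseteq B$ and $r(B)\le\alpha\, r(\mathsf{MEB}(X))$. The Guarded Ball Cover with parameter $\delta\in(0,1]$ processes a stream $S=(p_1,p_2,\dots,p_n)$, $n\ge 1$, of points of $\mathbb{R}^d$ (repetitions allowed) in one pass. It stores $p_1$ and a collection $\mathcal{B}$ of triplets $(c,r,q)$ consisting of a center, a radius and a guard $q\in S$; initially $\mathcal{B}=\{(p_1,0,p_1)\}$. Let $Q$ be the set consisting of $p_1$ and of the guards of the triplets in $\mathcal{B}$. When a new point $p$ arrives: if $p\in B(c,(1+\delta)r)$ for some $(c,r,q)\in\mathcal{B}$, then $p$ is discarded; otherwise let $B(c,r)=\mathsf{MEB}(Q\cup\{p\})$, delete from $\mathcal{B}$ all triplets $(c',r',p')$ with $r'<\delta^2r/80$,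 and add $(c,r,p)$ to $\mathcal{B}$. The number of stored points is $1+2|\mathcal{B}|$ (the point $p_1$, and a center and a guard for each ball). Let $B_\delta(S)$ be the $\mathsf{MEB}$ of the union of the balls $B(c,r)$, $(c,r,q)\in\mathcal{B}$, after $S$ has been processed. Corollary. There is an absolute constant $C>0$ such that for every dimension $d\ge 0$, every $\varepsilon\in(0,1]$ and every nonempty finite stream $S$ in $\mathbb{R}^d$ (hence, at all times, for the part of a stream that has arrived so far): 1. The Guarded Ball Cover with parameter $\varepsilon$ has at most $C\varepsilon^{-2}\log(2/\varepsilon)$ stored points, $r(B_\varepsilon(S))\le(1.22+\varepsilon)\, r(\mathsf{MEB}(S))$, and $S\subseteq(1+\varepsilon)B_\varepsilon(S)$. 2. The Guarded Ball Cover with parameter $\varepsilon/4$ has at most $C\varepsilon^{-2}\log(2/\varepsilon)$ stored points, and the ball $(1+\varepsilon/4)B_{\varepsilon/4}(S)$ is a $(1.22+\varepsilon)$-$\mathsf{MEB}(S)$, that is, it contains $S$ and its radius is at most $(1.22+\varepsilon)\, r(\mathsf{MEB}(S))$. -/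

import Mathlib

namespace GuardedBallCover

/-- The space `ℝ^d` with the Euclidean distance. -/
abbrev Pt (d : ℕ) : Type := EuclideanSpace ℝ (Fin d)

/-- A ball `B(c, r)`, given by its center and its radius. -/
structure Ball (d : ℕ) where
  center : Pt d
  radius : ℝ

/-- The set of points of a (closed) ball. -/
def Ball.toSet {d : ℕ} (B : Ball d) : Set (Pt d) := Metric.closedBall B.center B.radius

/-- The `a`-expansion of the ball `B(c, r)` is the ball `B(c, a * r)`. -/
def Ball.expand {d : ℕ} (a : ℝ) (B : Ball d) : Ball d := ⟨B.center, a * B.radius⟩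

/-- `B` is a minimum enclosing ball of `X`: it contains `X`, and no ball that contains `X`
has a smaller radius. -/
def IsMEB {d : ℕ} (X : Set (Pt d)) (B : Ball d) : Prop :=
  0 ≤ B.radius ∧ X ⊆ B.toSet ∧ ∀ B' : Ball d, 0 ≤ B'.radius → X ⊆ B'.toSet → B.radius ≤ B'.radius

/-- A bounded set has a minimum enclosing ball. -/
theorem exists_isMEB {d : ℕ} (X : Set (Pt d)) (hb : Bornology.IsBounded X) :
    ∃ B, IsMEB X B := by
  rcases X.eq_empty_or_nonempty with rfl | ⟨x₀, hx₀⟩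
  · exact ⟨⟨0, 0⟩, le_rfl, Set.empty_subset _, fun B' h _ => h⟩
  set R : Set ℝ := {r | 0 ≤ r ∧ ∃ c : Pt d, X ⊆ Metric.closedBall c r} with hR
  have hRb : BddBelow R := ⟨0, fun r hr => hr.1⟩
  have hRn : R.Nonempty := by
    obtain ⟨r, hr⟩ := hb.subset_closedBall x₀
    refine ⟨max r 0, le_max_right _ _, x₀, hr.trans ?_⟩
    exact Metric.closedBall_subset_closedBall (le_max_left _ _)
  have hr0 : 0 ≤ sInf R := le_csInf hRn fun r hr => hr.1
  have key : (⋂ n : ℕ, ⋂ x ∈ X, Metric.closedBall x (sInf R + 1 / ((n : ℝ) + 1))).Nonempty := by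
    apply IsCompact.nonempty_iInter_of_sequence_nonempty_isCompact_isClosed
    · intro n
      refine Set.iInter₂_mono fun x _ => Metric.closedBall_subset_closedBall ?_
      have : 1 / (((n + 1 : ℕ) : ℝ) + 1) ≤ 1 / ((n : ℝ) + 1) :=
        one_div_le_one_div_of_le (by positivity) (by push_cast; linarith)
      linarith
    · intro n
      have hlt : sInf R < sInf R + 1 / ((n : ℝ) + 1) := by
        have : 0 < 1 / ((n : ℝ) + 1) := by positivity
        linarith
      obtain ⟨r, ⟨_, c, hc⟩, hlt'⟩ := exists_lt_of_csInf_lt hRn hlt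
      refine ⟨c, Set.mem_iInter₂.2 fun x hx => ?_⟩
      have h1 := hc hx
      rw [Metric.mem_closedBall] at h1 ⊢
      rw [dist_comm]
      linarith
    · refine (isCompact_closedBall x₀ (sInf R + 1 / (((0 : ℕ) : ℝ) + 1))).of_isClosed_subset ?_ ?_
      · exact isClosed_biInter fun x _ => Metric.isClosed_closedBall
      · exact Set.iInter₂_subset x₀ hx₀
    · intro n
      exact isClosed_biInter fun x _ => Metric.isClosed_closedBall
  obtain ⟨c, hc⟩ := key
  refine ⟨⟨c, sInf R⟩, hr0, fun x hx => ?_, fun B' h0 hX => csInf_le hRb ⟨h0, B'.center, hX⟩⟩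
  refine Metric.mem_closedBall.2 (le_of_forall_pos_le_add fun δ hδ => ?_)
  obtain ⟨n, hn⟩ := exists_nat_one_div_lt hδ
  have h1 := Set.mem_iInter₂.1 (Set.mem_iInter.1 hc n) x hx
  rw [Metric.mem_closedBall, dist_comm] at h1
  simp only at h1 ⊢
  linarith

/-- A nonempty set has at most one minimum enclosing ball. -/
theorem IsMEB.unique {d : ℕ} {X : Set (Pt d)} (hX : X.Nonempty) {B B' : Ball d}
    (h : IsMEB X B) (h' : IsMEB X B') : B = B' := by
  have hr : B.radius = B'.radius :=
    le_antisymm (h.2.2 B' h'.1 h'.2.1) (h'.2.2 B h.1 h.2.1)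
  obtain ⟨c, r⟩ := B
  obtain ⟨c', r'⟩ := B'
  obtain rfl : r = r' := hr
  suffices hc : c = c' by rw [hc]
  obtain ⟨h0, hs, hm⟩ := h
  obtain ⟨-, hs', -⟩ := h'
  simp only at h0 hm
  have hmid : ∀ x ∈ X, dist x (midpoint ℝ c c') ^ 2 ≤ r ^ 2 - (dist c c' / 2) ^ 2 := by
    intro x hx
    have h1 : dist x c ≤ r := Metric.mem_closedBall.1 (hs hx)
    have h2 : dist x c' ≤ r := Metric.mem_closedBall.1 (hs' hx)
    have hp := EuclideanGeometry.dist_sq_add_dist_sq_eq_two_mul_dist_midpoint_sq_add_half_dist_sq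
      x c c'
    have h1' : dist x c ^ 2 ≤ r ^ 2 := by gcongr
    have h2' : dist x c' ^ 2 ≤ r ^ 2 := by gcongr
    linarith
  obtain ⟨x₀, hx₀⟩ := hX
  have hnn : 0 ≤ r ^ 2 - (dist c c' / 2) ^ 2 := (sq_nonneg _).trans (hmid x₀ hx₀)
  have hle := hm ⟨midpoint ℝ c c', Real.sqrt (r ^ 2 - (dist c c' / 2) ^ 2)⟩ (Real.sqrt_nonneg _)
    fun x hx => Metric.mem_closedBall.2 (Real.le_sqrt_of_sq_le (hmid x hx))
  simp only at hle
  have hsq : r ^ 2 ≤ r ^ 2 - (dist c c' / 2) ^ 2 := by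
    calc r ^ 2 ≤ Real.sqrt (r ^ 2 - (dist c c' / 2) ^ 2) ^ 2 := by gcongr
      _ = _ := Real.sq_sqrt hnn
  have h3 : (dist c c' / 2) ^ 2 = 0 := le_antisymm (by linarith) (sq_nonneg _)
  have h4 : dist c c' / 2 = 0 := pow_eq_zero_iff (two_ne_zero) |>.1 h3
  exact dist_eq_zero.1 (by linarith)

open Classical in
/-- The minimum enclosing ball `MEB(X)`. It exists and is unique for every nonempty bounded `X`;
the value is a dummy for unbounded sets. -/
noncomputable def meb {d : ℕ} (X : Set (Pt d)) : Ball d :=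
  if h : ∃ B, IsMEB X B then h.choose else ⟨0, 0⟩

theorem isMEB_meb {d : ℕ} (X : Set (Pt d)) (hb : Bornology.IsBounded X) : IsMEB X (meb X) := by
  have h := exists_isMEB X hb
  unfold meb
  rw [dif_pos h]
  exact h.choose_spec

/-- `B` is an `α`-approximate minimum enclosing ball of `X`: it contains `X`, and its radius is
at most `α` times the radius of `MEB(X)`. -/
def IsApproxMEB {d : ℕ} (α : ℝ) (X : Set (Pt d)) (B : Ball d) : Prop :=
  X ⊆ B.toSet ∧ B.radius ≤ α * (meb X).radius

/-- A guarded ball: a triplet `(c, r, q)` of a center, a radius and a guard. -/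
structure GuardedBall (d : ℕ) extends Ball d where
  guard : Pt d

/-- The memory of the streaming algorithm: the first point `p₁` of the stream and the collection
`𝓑` of guarded balls. -/
structure Memory (d : ℕ) where
  first : Pt d
  balls : List (GuardedBall d)

/-- The coreset `Q`, which consists of `p₁` and of the guards of the balls in `𝓑`. -/
def Memory.coreset {d : ℕ} (M : Memory d) : Set (Pt d) :=
  insert M.first {q | ∃ B ∈ M.balls, B.guard = q}

/-- The union of the stored balls. -/
def Memory.union {d : ℕ} (M : Memory d) : Set (Pt d) :=
  {x | ∃ B ∈ M.balls, x ∈ B.toBall.toSet}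

/-- `p` lies in the expansion `(1 + ε)𝓑`. -/
def Memory.Covers {d : ℕ} (ε : ℝ) (M : Memory d) (p : Pt d) : Prop :=
  ∃ B ∈ M.balls, p ∈ (B.toBall.expand (1 + ε)).toSet

/-- The number of points in memory: `p₁`, and a center and a guard for each ball. -/
def Memory.numPoints {d : ℕ} (M : Memory d) : ℕ := 1 + 2 * M.balls.length

/-- The memory after the arrival of the first point `p₁`. -/
def start {d : ℕ} (p₁ : Pt d) : Memory d := ⟨p₁, [⟨⟨p₁, 0⟩, p₁⟩]⟩

open Classical in
/-- Processing of a new point `p`. If `p` lies in `(1 + ε)𝓑`, it is discarded. Otherwise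
`B = (c, r) = MEB(Q ∪ {p})` is added with guard `p`, and all balls of radius less than
`ε² r / 80` are deleted. -/
noncomputable def process {d : ℕ} (ε : ℝ) (M : Memory d) (p : Pt d) : Memory d :=
  if M.Covers ε p then M
  else
    let B : Ball d := meb (M.coreset ∪ {p})
    ⟨M.first, ⟨B, p⟩ :: M.balls.filter fun B' => decide (ε ^ 2 * B.radius / 80 ≤ B'.radius)⟩

/-- The Guarded Ball Cover with parameter `ε`, after the stream whose first point is `p₁` and
whose further points, in the order of arrival, are those of the list `s`. -/
noncomputable def cover {d : ℕ} (ε : ℝ) (p₁ : Pt d) (s : List (Pt d)) : Memory d :=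
  s.foldl (process ε) (start p₁)

/-- The points of the stream. -/
def points {d : ℕ} (p₁ : Pt d) (s : List (Pt d)) : Set (Pt d) := {x | x ∈ p₁ :: s}

end GuardedBallCover

/-! Every stored ball is the MEB of a subset of `S`, so its radius is at most `ρ = r(MEB(S))`. A
deleted guard lies so close to `p₁` that each new ball, slightly enlarged, still contains the sets
that define the older balls. Hence the balls behave like MEBs of nested sets: `|c - c'|² + r'² ≤ ((1
+ ε²/40) r)²` for an older ball `(c', r')` (`IsMEB.dist_sq_add_sq_le`). As a new point lies outside
the `(1 + ε)`-expansion of the last ball, this also forces the radius to grow by a factor `1 + ε²/5`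
(`radius_growth`). With the deletion threshold `ε²r/80`, only `O(ε⁻² log(2/ε))` balls survive.

For the radius `R` of the ball around the union, write its center `c₀` as a convex combination, with
weights `w`, of the centers of the balls that touch its boundary, and put `x i = r i / R`. Averaging
the inner products of `c i - c₀` with the `c j - c₀` gives zero; near-nestedness bounds them below
and yields `1 - t + E min(t, X)² - E X ≤ e` at every `t` in the support of `X`, hence for all `t ≥
1/2` (`one_sub_add_sum_le`). Integrating against a suitable probability measure on `[1/2, N]`, with
`X ≤ N`, gives `1/4 - log(2N)/2 ≤ e` (`quarter_sub_log_le`). Without the error `e` this says `R/ρ ≤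
2/√exp(1) ≈ 1.2131`; the gap to `1.22` and the extra `δ/10` absorb the errors. -/

namespace GuardedBallCover

/-! ### Geometry of minimum enclosing balls. -/

/-- A ball that contains `K` has squared radius at least `r² + |c - c'|²`, where `(c, r)` is the
minimum enclosing ball of `K` and `c'` is the center of the ball. -/
theorem IsMEB.dist_sq_add_sq_le {d : ℕ} {K : Set (Pt d)} (hK : K.Nonempty) {B : Ball d}
    (h : IsMEB K B) {c' : Pt d} {r' : ℝ} (hK' : K ⊆ Metric.closedBall c' r') :
    dist B.center c' ^ 2 + B.radius ^ 2 ≤ r' ^ 2 := by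
  obtain ⟨c, r⟩ := B
  obtain ⟨h0, hs, hm⟩ := h
  simp only at h0 hm ⊢
  -- Moving the center from `c` to `c + t (c' - c)` cannot decrease the enclosing radius below `r`.
  -- Expanding the squared distances and dividing by `t` gives this bound; then `t → 0`.
  have key : ∀ t : ℝ, 0 < t → t ≤ 1 → r ^ 2 ≤ r' ^ 2 - (1 - t) * dist c c' ^ 2 := by
    intro t ht0 ht1
    have hx : ∀ x ∈ K, dist x (c + t • (c' - c)) ^ 2 ≤
        (1 - t) * r ^ 2 + t * r' ^ 2 - t * (1 - t) * dist c c' ^ 2 := by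
      intro x hx
      have h1 : dist x c ≤ r := Metric.mem_closedBall.1 (hs hx)
      have h2 : dist x c' ≤ r' := Metric.mem_closedBall.1 (hK' hx)
      have h1' : dist x c ^ 2 ≤ r ^ 2 := by gcongr
      have h2' : dist x c' ^ 2 ≤ r' ^ 2 := by gcongr
      have e : dist x (c + t • (c' - c)) ^ 2 =
          (1 - t) * dist x c ^ 2 + t * dist x c' ^ 2 - t * (1 - t) * dist c c' ^ 2 := by
        rw [dist_eq_norm, dist_eq_norm, dist_eq_norm, dist_eq_norm]
        have e1 : x - (c + t • (c' - c)) = (x - c) - t • (c' - c) := by abel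
        have e2 : x - c' = (x - c) - (c' - c) := by abel
        rw [e1, e2, norm_sub_rev c c']
        generalize x - c = a
        generalize c' - c = b
        rw [norm_sub_sq_real, norm_sub_sq_real, inner_smul_right, norm_smul, mul_pow,
          Real.norm_eq_abs, sq_abs]
        ring
      rw [e]
      have h3 : (1 - t) * dist x c ^ 2 ≤ (1 - t) * r ^ 2 :=
        mul_le_mul_of_nonneg_left h1' (by linarith)
      have h4 : t * dist x c' ^ 2 ≤ t * r' ^ 2 := mul_le_mul_of_nonneg_left h2' ht0.le
      linarith
    obtain ⟨x₀, hx₀⟩ := hK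
    have hnn := (sq_nonneg _).trans (hx x₀ hx₀)
    have hle := hm ⟨c + t • (c' - c), Real.sqrt _⟩ (Real.sqrt_nonneg _)
      fun x hxK => Metric.mem_closedBall.2 (Real.le_sqrt_of_sq_le (hx x hxK))
    simp only at hle
    have hsq : r ^ 2 ≤ (1 - t) * r ^ 2 + t * r' ^ 2 - t * (1 - t) * dist c c' ^ 2 := by
      rw [← Real.sq_sqrt hnn]
      gcongr
    have : t * r ^ 2 ≤ t * (r' ^ 2 - (1 - t) * dist c c' ^ 2) := by linarith
    exact le_of_mul_le_mul_left this ht0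
  have hlim : Filter.Tendsto (fun t : ℝ => r' ^ 2 - (1 - t) * dist c c' ^ 2)
      (nhdsWithin 0 (Set.Ioi 0)) (nhds (r' ^ 2 - (1 - 0) * dist c c' ^ 2)) :=
    (Continuous.tendsto (by fun_prop) 0).mono_left nhdsWithin_le_nhds
  have := ge_of_tendsto hlim (b := r ^ 2) (by
    filter_upwards [Ioc_mem_nhdsGT (zero_lt_one (α := ℝ))] with t ht using key t ht.1 ht.2)
  linarith

/-- In dimension at least one, a ball inside a ball is as far from its boundary as the centers
tell. -/
theorem dist_add_le_of_closedBall_subset {E : Type*} [NormedAddCommGroup E] [NormedSpace ℝ E]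
    [Nontrivial E] {c c' : E} {r r' : ℝ} (hr : 0 ≤ r)
    (h : Metric.closedBall c r ⊆ Metric.closedBall c' r') : dist c c' + r ≤ r' := by
  obtain ⟨u, hu, hcu⟩ : ∃ u : E, ‖u‖ = 1 ∧ c - c' = ‖c - c'‖ • u := by
    by_cases hc : c - c' = 0
    · obtain ⟨u, hu⟩ := exists_norm_eq E (zero_le_one (α := ℝ))
      exact ⟨u, hu, by simp [hc]⟩
    · refine ⟨‖c - c'‖⁻¹ • (c - c'), norm_smul_inv_norm hc, ?_⟩
      rw [smul_smul, mul_inv_cancel₀ (norm_ne_zero_iff.2 hc), one_smul]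
  have h1 : c + r • u ∈ Metric.closedBall c r := by
    simp [Metric.mem_closedBall, norm_smul, hu, abs_of_nonneg hr]
  have h2 := Metric.mem_closedBall.1 (h h1)
  have e : c + r • u - c' = (‖c - c'‖ + r) • u := by
    rw [add_smul, ← hcu]
    abel
  rw [dist_eq_norm, e, norm_smul, hu, mul_one, Real.norm_eq_abs] at h2
  rw [dist_eq_norm]
  exact (le_abs_self _).trans h2

/-- The center of the smallest ball around finitely many balls is a convex combination of the
centers of those balls that touch its boundary. -/
theorem exists_weights_of_minimal {E : Type*} [NormedAddCommGroup E] [InnerProductSpace ℝ E]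
    [CompleteSpace E] {ι : Type*} [Fintype ι] [Nonempty ι]
    {c : ι → E} {r : ι → ℝ} {c₀ : E} {R : ℝ}
    (hin : ∀ i, dist (c i) c₀ + r i ≤ R)
    (hmin : ∀ c' R', (∀ i, dist (c i) c' + r i ≤ R') → R ≤ R') :
    ∃ w : ι → ℝ, (∀ i, 0 ≤ w i) ∧ ∑ i, w i = 1 ∧ (∀ i, w i ≠ 0 → dist (c i) c₀ + r i = R) ∧
      ∑ i, w i • c i = c₀ := by
  classical
  set T : Set ι := {i | dist (c i) c₀ + r i = R} with hT
  set W : Set E := {x | ∃ w : ι → ℝ, (∀ i, 0 ≤ w i) ∧ ∑ i, w i = 1 ∧ (∀ i, w i ≠ 0 → i ∈ T) ∧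
    ∑ i, w i • c i = x} with hW
  have hsub : convexHull ℝ (c '' T) ⊆ W := by
    refine convexHull_min ?_ ?_
    · rintro _ ⟨i, hi, rfl⟩
      refine ⟨Pi.single i 1, fun j => ?_, by simp, fun j hj => ?_, ?_⟩
      · by_cases h : j = i
        · subst h; simp
        · simp [h]
      · by_cases h : j = i
        · rwa [h]
        · simp [h] at hj
      · rw [Finset.sum_eq_single i] <;> simp +contextual
    · rintro x ⟨w, h0, h1, hs, rfl⟩ y ⟨v, g0, g1, gs, rfl⟩ a b ha hb hab
      refine ⟨fun i => a * w i + b * v i, fun i => ?_, ?_, fun i hi => ?_, ?_⟩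
      · have := h0 i
        have := g0 i
        positivity
      · rw [Finset.sum_add_distrib, ← Finset.mul_sum, ← Finset.mul_sum, h1, g1]
        linarith
      · by_contra hiT
        have e1 : w i = 0 := by by_contra h; exact hiT (hs i h)
        have e2 : v i = 0 := by by_contra h; exact hiT (gs i h)
        simp [e1, e2] at hi
      · simp_rw [add_smul, mul_smul, Finset.sum_add_distrib, Finset.smul_sum]
  suffices hc : c₀ ∈ convexHull ℝ (c '' T) by
    obtain ⟨w, h⟩ := hsub hc
    exact ⟨w, h⟩
  by_contra hc
  obtain ⟨f, a, hf0, hf⟩ := geometric_hahn_banach_point_closed (convex_convexHull ℝ (c '' T))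
    ((T.toFinite.image c).isClosed_convexHull ℝ) hc
  set u : E := (InnerProductSpace.toDual ℝ E).symm f with hu
  have hfu : ∀ x, f x = inner ℝ u x := fun x => by
    rw [hu, InnerProductSpace.toDual_symm_apply]
  have hpos : ∀ i ∈ T, 0 < inner ℝ (c i - c₀) u := by
    intro i hi
    have h1 := hf (c i) (subset_convexHull ℝ _ ⟨i, hi, rfl⟩)
    rw [hfu] at h1 hf0
    rw [real_inner_comm, inner_sub_right]
    linarith
  -- If `c₀` could be separated from the touching centers, a small shift in the separating direction
  -- `u` would bring it closer to all of them, while the other balls have slack. This contradicts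
  -- the minimality of `R`.
  have hev : ∀ i, ∀ᶠ t : ℝ in nhdsWithin 0 (Set.Ioi 0), dist (c i) (c₀ + t • u) + r i < R := by
    intro i
    by_cases hi : i ∈ T
    · have hlim : Filter.Tendsto (fun t : ℝ => -2 * inner ℝ (c i - c₀) u + t * ‖u‖ ^ 2)
          (nhdsWithin 0 (Set.Ioi 0)) (nhds (-2 * inner ℝ (c i - c₀) u + 0 * ‖u‖ ^ 2)) :=
        (Continuous.tendsto (by fun_prop) 0).mono_left nhdsWithin_le_nhds
      have hneg : -2 * inner ℝ (c i - c₀) u + 0 * ‖u‖ ^ 2 < 0 := by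
        have := hpos i hi
        linarith
      filter_upwards [hlim.eventually_lt_const hneg, self_mem_nhdsWithin] with t ht ht0
      have ht0' : 0 < t := ht0
      have e : dist (c i) (c₀ + t • u) ^ 2 =
          dist (c i) c₀ ^ 2 + t * (-2 * inner ℝ (c i - c₀) u + t * ‖u‖ ^ 2) := by
        rw [dist_eq_norm, dist_eq_norm, ← sub_sub, norm_sub_sq_real, inner_smul_right, norm_smul,
          mul_pow, Real.norm_eq_abs, sq_abs]
        ring
      have hlt : dist (c i) (c₀ + t • u) < dist (c i) c₀ := by
        refine lt_of_pow_lt_pow_left₀ 2 dist_nonneg ?_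
        rw [e]
        have := mul_neg_of_pos_of_neg ht0' ht
        linarith
      have : dist (c i) c₀ + r i = R := hi
      linarith
    · have hlt : dist (c i) (c₀ + (0 : ℝ) • u) + r i < R := by
        rw [zero_smul, add_zero]
        exact lt_of_le_of_ne (hin i) hi
      have hcont : Filter.Tendsto (fun t : ℝ => dist (c i) (c₀ + t • u) + r i)
          (nhdsWithin 0 (Set.Ioi 0)) (nhds (dist (c i) (c₀ + (0 : ℝ) • u) + r i)) :=
        (Continuous.tendsto (by fun_prop) 0).mono_left nhdsWithin_le_nhds
      exact hcont.eventually_lt_const hlt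
  obtain ⟨t, ht⟩ := (Filter.eventually_all.2 hev).exists
  obtain ⟨j, hj⟩ := Finite.exists_max fun i => dist (c i) (c₀ + t • u) + r i
  exact absurd (hmin _ _ hj) (not_le.2 (ht j))

/-! ### The integral inequality behind the constant. -/

open intervalIntegral in
-- The density `1/(2t²)` on `[1/2, N]` and the atom `1/(2N)` at `N` form a probability measure. It
-- is chosen to make the average of `min(t, x)² - x` equal to `-1/4` for every `x` in `[1/2, N]`;
-- for `x ≤ 1/2` the average is `x² - x ≥ -1/4`.
theorem integral_min_sq_div {x N : ℝ} (hxN : x ≤ N) (hN : 1 / 2 ≤ N) :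
    -(1 / 4) ≤ (∫ t in (1 / 2 : ℝ)..N, (min t x ^ 2 - x) / (2 * t ^ 2)) +
      (min N x ^ 2 - x) / (2 * N) := by
  have hNpos : 0 < N := by linarith
  have hI : ∀ a b k : ℝ, 0 < a → 0 < b →
      ∫ t in a..b, k / (2 * t ^ 2) = k / (2 * a) - k / (2 * b) := by
    intro a b k ha hb
    have hne : ∀ t ∈ Set.uIcc a b, t ≠ 0 := fun t ht => by
      have := (lt_min ha hb).trans_le ht.1
      exact this.ne'
    rw [integral_eq_sub_of_hasDerivAt (f := fun t => -(k / 2) * t⁻¹)]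
    · field_simp
      ring
    · intro t ht
      refine ((hasDerivAt_inv (hne t ht)).const_mul (-(k / 2))).congr_deriv ?_
      have := hne t ht
      field_simp
    · refine ContinuousOn.intervalIntegrable ?_
      refine ContinuousOn.div (by fun_prop) (by fun_prop) fun t ht => ?_
      have := hne t ht
      positivity
  rcases le_total x (1 / 2) with h | h
  · have e : ∫ t in (1 / 2 : ℝ)..N, (min t x ^ 2 - x) / (2 * t ^ 2) =
        ∫ t in (1 / 2 : ℝ)..N, (x ^ 2 - x) / (2 * t ^ 2) := by
      refine integral_congr fun t ht => ?_
      rw [Set.uIcc_of_le hN] at ht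
      simp only [min_eq_right (h.trans ht.1)]
    rw [e, hI _ _ _ (by norm_num) hNpos, min_eq_right hxN]
    have := sq_nonneg (x - 1 / 2)
    norm_num
    linarith
  · have hxpos : 0 < x := by linarith
    have hcont : ∀ a b : ℝ, 0 < a → 0 < b → IntervalIntegrable
        (fun t : ℝ => (min t x ^ 2 - x) / (2 * t ^ 2)) MeasureTheory.volume a b := by
      intro a b ha hb
      refine ContinuousOn.intervalIntegrable ?_
      refine ContinuousOn.div (by fun_prop) (by fun_prop) fun t ht => ?_
      have : 0 < t := (lt_min ha hb).trans_le ht.1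
      positivity
    rw [← integral_add_adjacent_intervals (hcont (1 / 2) x (by norm_num) hxpos)
      (hcont x N hxpos hNpos)]
    have e1 : ∫ t in (1 / 2 : ℝ)..x, (min t x ^ 2 - x) / (2 * t ^ 2) =
        ∫ t in (1 / 2 : ℝ)..x, (1 / 2 - x / (2 * t ^ 2)) := by
      refine integral_congr fun t ht => ?_
      rw [Set.uIcc_of_le h] at ht
      have : 0 < t := by linarith [ht.1]
      simp only [min_eq_left ht.2]
      field_simp
    have e2 : ∫ t in x..N, (min t x ^ 2 - x) / (2 * t ^ 2) =
        ∫ t in x..N, (x ^ 2 - x) / (2 * t ^ 2) := by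
      refine integral_congr fun t ht => ?_
      rw [Set.uIcc_of_le hxN] at ht
      simp only [min_eq_right ht.1]
    have hi : IntervalIntegrable (fun t : ℝ => x / (2 * t ^ 2)) MeasureTheory.volume (1 / 2) x := by
      refine ContinuousOn.intervalIntegrable ?_
      refine ContinuousOn.div (by fun_prop) (by fun_prop) fun t ht => ?_
      rw [Set.uIcc_of_le h] at ht
      have : 0 < t := by linarith [ht.1]
      positivity
    rw [e1, e2, integral_sub (by simp) hi, hI _ _ _ (by norm_num) hxpos, hI _ _ _ hxpos hNpos,
      min_eq_right hxN, integral_const, smul_eq_mul]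
    apply le_of_eq
    field_simp
    ring

open intervalIntegral in
/-- A distribution on `[0, N]` with `1 - t - E X + E min(t, X)² ≤ e` for `1/2 ≤ t ≤ N` satisfies
`1/4 - log(2 N)/2 ≤ e`. -/
theorem quarter_sub_log_le {ι : Type*} [Fintype ι] {w x : ι → ℝ} {N e : ℝ}
    (hw : ∀ i, 0 ≤ w i) (hw1 : ∑ i, w i = 1) (hxN : ∀ i, x i ≤ N)
    (hN : 1 / 2 ≤ N)
    (hf : ∀ t, 1 / 2 ≤ t → t ≤ N → 1 - t + ∑ i, w i * (min t (x i) ^ 2 - x i) ≤ e) :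
    1 / 4 - Real.log (2 * N) / 2 ≤ e := by
  have hNpos : 0 < N := by linarith
  have hpos : ∀ t ∈ Set.uIcc (1 / 2) N, 0 < t := fun t ht => by
    rw [Set.uIcc_of_le hN] at ht
    linarith [ht.1]
  have hii : ∀ i, IntervalIntegrable (fun t : ℝ => w i * ((min t (x i) ^ 2 - x i) / (2 * t ^ 2)))
      MeasureTheory.volume (1 / 2) N := by
    intro i
    refine ContinuousOn.intervalIntegrable ?_
    refine ContinuousOn.mul (by fun_prop) (ContinuousOn.div (by fun_prop) (by fun_prop) fun t ht => ?_)
    have := hpos t ht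
    positivity
  have hiS : IntervalIntegrable
      (fun t : ℝ => ∑ i, w i * ((min t (x i) ^ 2 - x i) / (2 * t ^ 2)))
      MeasureTheory.volume (1 / 2) N := by
    have h := IntervalIntegrable.sum Finset.univ fun i _ => hii i
    rwa [Finset.sum_fn] at h
  have hi0 : IntervalIntegrable (fun t : ℝ => (1 - t) / (2 * t ^ 2))
      MeasureTheory.volume (1 / 2) N := by
    refine ContinuousOn.intervalIntegrable ?_
    refine ContinuousOn.div (by fun_prop) (by fun_prop) fun t ht => ?_
    have := hpos t ht
    positivity
  have hie : IntervalIntegrable (fun t : ℝ => e / (2 * t ^ 2))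
      MeasureTheory.volume (1 / 2) N := by
    refine ContinuousOn.intervalIntegrable ?_
    refine ContinuousOn.div (by fun_prop) (by fun_prop) fun t ht => ?_
    have := hpos t ht
    positivity
  have hprim : ∀ a b : ℝ, ∫ t in (1 / 2 : ℝ)..N, (a - b * t) / (2 * t ^ 2) =
      a - a / (2 * N) - b * Real.log (2 * N) / 2 := by
    intro a b
    rw [integral_eq_sub_of_hasDerivAt (f := fun t => -(a / 2) * t⁻¹ - b / 2 * Real.log t)]
    · rw [Real.log_mul (by norm_num) hNpos.ne', one_div, Real.log_inv]
      field_simp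
      ring
    · intro t ht
      have ht0 := (hpos t ht).ne'
      refine (((hasDerivAt_inv ht0).const_mul (-(a / 2))).sub
        ((Real.hasDerivAt_log ht0).const_mul (b / 2))).congr_deriv ?_
      field_simp
    · refine ContinuousOn.intervalIntegrable ?_
      refine ContinuousOn.div (by fun_prop) (by fun_prop) fun t ht => ?_
      have := hpos t ht
      positivity
  have hmono : ∫ t in (1 / 2 : ℝ)..N, ((1 - t) / (2 * t ^ 2) +
        ∑ i, w i * ((min t (x i) ^ 2 - x i) / (2 * t ^ 2))) ≤
      ∫ t in (1 / 2 : ℝ)..N, e / (2 * t ^ 2) := by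
    refine integral_mono_on hN (hi0.add hiS) hie
      fun t ht => ?_
    have h1 := hf t ht.1 ht.2
    have ht0 : 0 < t := by linarith [ht.1]
    have e1 : (1 - t) / (2 * t ^ 2) + ∑ i, w i * ((min t (x i) ^ 2 - x i) / (2 * t ^ 2)) =
        (1 - t + ∑ i, w i * (min t (x i) ^ 2 - x i)) / (2 * t ^ 2) := by
      rw [add_div, Finset.sum_div]
      simp_rw [mul_div_assoc]
    rw [e1]
    gcongr
  rw [integral_add hi0 hiS,
    integral_finsetSum fun i _ => hii i] at hmono
  simp_rw [integral_const_mul] at hmono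
  have h1 := hprim 1 1
  have h2 := hprim e 0
  simp only [one_mul, zero_mul, sub_zero, zero_div] at h1 h2
  rw [h1, h2] at hmono
  -- The contribution of the atom at `N`.
  have hend : (1 - N) / (2 * N) + ∑ i, w i * ((min N (x i) ^ 2 - x i) / (2 * N)) ≤ e / (2 * N) := by
    have h1 := hf N hN le_rfl
    have e1 : (1 - N) / (2 * N) + ∑ i, w i * ((min N (x i) ^ 2 - x i) / (2 * N)) =
        (1 - N + ∑ i, w i * (min N (x i) ^ 2 - x i)) / (2 * N) := by
      rw [add_div, Finset.sum_div]
      simp_rw [mul_div_assoc]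
    rw [e1]
    gcongr
  have hsum : -(1 / 4) ≤ ∑ i, w i * ((∫ t in (1 / 2 : ℝ)..N,
      (min t (x i) ^ 2 - x i) / (2 * t ^ 2)) + (min N (x i) ^ 2 - x i) / (2 * N)) := by
    calc -(1 / 4) = ∑ i, w i * -(1 / 4) := by rw [← Finset.sum_mul, hw1, one_mul]
      _ ≤ _ := Finset.sum_le_sum fun i _ =>
        mul_le_mul_of_nonneg_left (integral_min_sq_div (hxN i) hN) (hw i)
  simp_rw [mul_add, Finset.sum_add_distrib] at hsum
  have e3 : (1 - N) / (2 * N) = 1 / (2 * N) - 1 / 2 := by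
    field_simp
  rw [e3] at hend
  linarith

end GuardedBallCover

/-! ### The radius bound for nearly nested balls. -/

namespace GuardedBallCover

/-- The function `t ↦ 1 - t + E min(t, X)² - E X` is bounded on `[1/2, ∞)` by its values on the
support of `X`. -/
theorem one_sub_add_sum_le {ι : Type*} [Fintype ι] {w x : ι → ℝ} {e : ℝ}
    (hw : ∀ i, 0 ≤ w i) (hw1 : ∑ i, w i = 1)
    (hf : ∀ i, w i ≠ 0 → 1 - x i + ∑ j, w j * (min (x i) (x j) ^ 2 - x j) ≤ e)
    {t : ℝ} (ht : 1 / 2 ≤ t) : 1 - t + ∑ j, w j * (min t (x j) ^ 2 - x j) ≤ e := by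
  classical
  have hsum : ∀ s, 1 - s + ∑ j, w j * (min s (x j) ^ 2 - x j) =
      ∑ j, w j * (1 - s + min s (x j) ^ 2 - x j) := by
    intro s
    have : ∀ j, w j * (1 - s + min s (x j) ^ 2 - x j) =
        w j * (1 - s) + w j * (min s (x j) ^ 2 - x j) := fun j => by ring
    simp_rw [this, Finset.sum_add_distrib, ← Finset.sum_mul, hw1, one_mul]
  have hterm : ∀ s, (∀ j, w j ≠ 0 →
      1 - t + min t (x j) ^ 2 - x j ≤ 1 - s + min s (x j) ^ 2 - x j) →
      1 - t + ∑ j, w j * (min t (x j) ^ 2 - x j) ≤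
        1 - s + ∑ j, w j * (min s (x j) ^ 2 - x j) := by
    intro s h
    rw [hsum, hsum]
    refine Finset.sum_le_sum fun j _ => ?_
    by_cases hj : w j = 0
    · simp [hj]
    · exact mul_le_mul_of_nonneg_left (h j hj) (hw j)
  set S : Finset ι := Finset.univ.filter fun i => w i ≠ 0 with hS
  have hSmem : ∀ i, i ∈ S ↔ w i ≠ 0 := fun i => by simp [hS]
  have hSne : S.Nonempty := by
    by_contra h
    rw [Finset.not_nonempty_iff_eq_empty] at h
    have h0 : ∀ i, w i = 0 := fun i => by
      by_contra hi
      have := (hSmem i).2 hi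
      simp [h] at this
    simp [h0] at hw1
  -- To the right of the support the function has slope `-1`, so its value at the largest support
  -- point dominates.
  rcases (S.filter fun i => t < x i).eq_empty_or_nonempty with hB | hB
  · have hle : ∀ j, w j ≠ 0 → x j ≤ t := fun j hj => by
      by_contra h
      have : j ∈ S.filter fun i => t < x i :=
        Finset.mem_filter.2 ⟨(hSmem j).2 hj, not_le.1 h⟩
      simp [hB] at this
    obtain ⟨a, haS, ha⟩ := S.exists_max_image x hSne
    refine (hterm (x a) fun j hj => ?_).trans (hf a ((hSmem a).1 haS))
    rw [min_eq_right (hle j hj), min_eq_right (ha j ((hSmem j).2 hj))]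
    have := hle a ((hSmem a).1 haS)
    linarith
  obtain ⟨b, hbB, hb⟩ := (S.filter fun i => t < x i).exists_min_image x hB
  obtain ⟨hbS, htb⟩ := Finset.mem_filter.1 hbB
  have hb' : ∀ j, w j ≠ 0 → t < x j → x b ≤ x j := fun j hj h =>
    hb j (Finset.mem_filter.2 ⟨(hSmem j).2 hj, h⟩)
  -- To the left of the support the function is `1 - t + t²` up to a constant, which increases from
  -- `t = 1/2` on.
  rcases (S.filter fun i => x i ≤ t).eq_empty_or_nonempty with hA | hA
  · have hlt : ∀ j, w j ≠ 0 → t < x j := fun j hj => by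
      by_contra h
      have : j ∈ S.filter fun i => x i ≤ t :=
        Finset.mem_filter.2 ⟨(hSmem j).2 hj, not_lt.1 h⟩
      simp [hA] at this
    refine (hterm (x b) fun j hj => ?_).trans (hf b ((hSmem b).1 hbS))
    rw [min_eq_left (hlt j hj).le, min_eq_left (hb' j hj (hlt j hj))]
    nlinarith
  obtain ⟨a, haA, ha⟩ := (S.filter fun i => x i ≤ t).exists_max_image x hA
  obtain ⟨haS, hat⟩ := Finset.mem_filter.1 haA
  have ha' : ∀ j, w j ≠ 0 → x j ≤ t → x j ≤ x a := fun j hj h =>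
    ha j (Finset.mem_filter.2 ⟨(hSmem j).2 hj, h⟩)
  have hab : 0 < x b - x a := by linarith
  set α := (x b - t) / (x b - x a) with hα
  set β := (t - x a) / (x b - x a) with hβ
  have hα0 : 0 ≤ α := div_nonneg (by linarith) hab.le
  have hβ0 : 0 ≤ β := div_nonneg (by linarith) hab.le
  have hαβ : α + β = 1 := by
    rw [hα, hβ, ← add_div, div_eq_one_iff_eq hab.ne']
    ring
  have htc : t = α * x a + β * x b := by
    rw [hα, hβ]
    field_simp
    ring
  clear_value α β
  -- Between neighbouring support points `x a ≤ t < x b` every summand is constant or quadratic in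
  -- `t`, apart from the linear term, so the function is convex there.
  have hconv : 1 - t + ∑ j, w j * (min t (x j) ^ 2 - x j) ≤
      α * (1 - x a + ∑ j, w j * (min (x a) (x j) ^ 2 - x j)) +
        β * (1 - x b + ∑ j, w j * (min (x b) (x j) ^ 2 - x j)) := by
    rw [hsum, hsum, hsum, Finset.mul_sum, Finset.mul_sum, ← Finset.sum_add_distrib]
    refine Finset.sum_le_sum fun j _ => ?_
    by_cases hj : w j = 0
    · simp [hj]
    have key : 1 - t + min t (x j) ^ 2 - x j ≤
        α * (1 - x a + min (x a) (x j) ^ 2 - x j) + β * (1 - x b + min (x b) (x j) ^ 2 - x j) := by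
      obtain rfl : β = 1 - α := by linarith
      rcases le_or_gt (x j) t with h | h
      · rw [min_eq_right h, min_eq_right (ha' j hj h), min_eq_right (h.trans htb.le)]
        apply le_of_eq
        linear_combination -htc
      · rw [min_eq_left h.le, min_eq_left (hat.trans h.le), min_eq_left (hb' j hj h)]
        have hc : t ^ 2 ≤ α * x a ^ 2 + (1 - α) * x b ^ 2 := by
          have := mul_nonneg (mul_nonneg hα0 hβ0) (sq_nonneg (x a - x b))
          rw [htc]
          linarith
        linarith
    calc _ ≤ w j * _ := mul_le_mul_of_nonneg_left key (hw j)
      _ = _ := by ring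
  have h1 := mul_le_mul_of_nonneg_left (hf a ((hSmem a).1 haS)) hα0
  have h2 := mul_le_mul_of_nonneg_left (hf b ((hSmem b).1 hbS)) hβ0
  have h3 : α * e + β * e = e := by rw [← add_mul, hαβ, one_mul]
  linarith

/-- With `N = 1/(1.22 + δ/10)` one has `1/(2N) = 0.61 (1 + δ/12.2)`. Since `0.61² > exp(-1)`, the
right side exceeds `δ/26.4`, while the error on the left is at most `0.034 δ`. -/
theorem log_expansion_bound {δ : ℝ} (h0 : 0 < δ) (h1 : δ ≤ 1) :
    (δ ^ 2 / 40 + (δ ^ 2 / 40) ^ 2 / 2) * (1 / (1.22 + δ / 10)) ^ 2 <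
      1 / 4 - Real.log (2 * (1 / (1.22 + δ / 10))) / 2 := by
  have hz : 0 < 1 + δ / 12.2 := by positivity
  have e1 : 2 * (1 / (1.22 + δ / 10)) = (0.61 * (1 + δ / 12.2))⁻¹ := by
    field_simp
    norm_num
    ring
  have hlog : -(1 / 2) < Real.log 0.61 := by
    rw [Real.lt_log_iff_exp_lt (by norm_num)]
    refine lt_of_pow_lt_pow_left₀ 2 (by norm_num) ?_
    rw [← Real.exp_nat_mul]
    norm_num
    have := Real.exp_neg_one_lt_d9
    linarith
  have hlog2 : δ / 13.2 ≤ Real.log (1 + δ / 12.2) := by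
    refine le_trans ?_ (Real.one_sub_inv_le_log_of_pos hz)
    have : 1 - (1 + δ / 12.2)⁻¹ = δ / (12.2 + δ) := by
      field_simp
      norm_num
    rw [this]
    gcongr
    linarith
  rw [e1, Real.log_inv, Real.log_mul (by norm_num) hz.ne']
  have hN : (1 / (1.22 + δ / 10)) ^ 2 ≤ 0.68 := by
    have : 1 / (1.22 + δ / 10) ≤ 1 / 1.22 := by
      gcongr
      linarith
    calc (1 / (1.22 + δ / 10)) ^ 2 ≤ (1 / 1.22) ^ 2 := by gcongr
      _ ≤ 0.68 := by norm_num
  have hη : δ ^ 2 / 40 + (δ ^ 2 / 40) ^ 2 / 2 ≤ δ / 20 := by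
    have h2 : δ ^ 2 ≤ δ := by nlinarith
    nlinarith
  have : (δ ^ 2 / 40 + (δ ^ 2 / 40) ^ 2 / 2) * (1 / (1.22 + δ / 10)) ^ 2 ≤ δ / 20 * 0.68 := by
    gcongr
  norm_num at *
  linarith

/-- The smallest ball around finitely many balls of radius at most `ρ`, whose centers are as close
as those of minimum enclosing balls of (almost) nested sets, has radius below `1.22 ρ`, up to an
error. -/
theorem radius_le_of_nested {E : Type*} [NormedAddCommGroup E] [InnerProductSpace ℝ E]
    [CompleteSpace E] {ι : Type*} [Fintype ι] [Nonempty ι]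
    {c : ι → E} {r : ι → ℝ} {c₀ : E} {R ρ δ : ℝ} (hδ0 : 0 < δ) (hδ1 : δ ≤ 1)
    (hr0 : ∀ i, 0 ≤ r i) (hrρ : ∀ i, r i ≤ ρ)
    (hpair : ∀ i j, dist (c i) (c j) ^ 2 + min (r i) (r j) ^ 2 ≤
      ((1 + δ ^ 2 / 40) * max (r i) (r j)) ^ 2)
    (hin : ∀ i, dist (c i) c₀ + r i ≤ R)
    (hmin : ∀ c' R', (∀ i, dist (c i) c' + r i ≤ R') → R ≤ R') :
    R ≤ (1.22 + δ / 10) * ρ := by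
  by_contra! hR
  set N : ℝ := 1 / (1.22 + δ / 10) with hN
  set η : ℝ := δ ^ 2 / 40 with hη
  have hden : 0 < 1.22 + δ / 10 := by positivity
  have hρ : 0 ≤ ρ := (hr0 (Classical.arbitrary ι)).trans (hrρ _)
  have hRpos : 0 < R := lt_of_le_of_lt (by positivity) hR
  obtain ⟨w, hw, hw1, hwT, hwc⟩ := exists_weights_of_minimal hin hmin
  set x : ι → ℝ := fun i => r i / R with hx
  have hrx : ∀ i, r i = R * x i := fun i => by
    simp only [hx]
    field_simp
  have hx0 : ∀ i, 0 ≤ x i := fun i => div_nonneg (hr0 i) hRpos.le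
  have hxN : ∀ i, x i ≤ N := fun i => by
    rw [hx, hN, div_le_div_iff₀ hRpos hden]
    have := mul_le_mul_of_nonneg_right (hrρ i) hden.le
    linarith
  have hN2 : 1 / 2 ≤ N := by
    rw [hN]
    apply one_div_le_one_div_of_le hden
    linarith
  have hf : ∀ i, w i ≠ 0 → 1 - x i + ∑ j, w j * (min (x i) (x j) ^ 2 - x j) ≤
      (η + η ^ 2 / 2) * N ^ 2 := by
    intro i hi
    have hzero : ∑ j, w j * inner ℝ (c i - c₀) (c j - c₀) = 0 := by
      have : ∑ j, w j • (c j - c₀) = 0 := by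
        simp_rw [smul_sub, Finset.sum_sub_distrib, ← Finset.sum_smul, hwc, hw1, one_smul, sub_self]
      have h2 := congrArg (fun v => inner ℝ (c i - c₀) v) this
      simpa [inner_sum, inner_smul_right] using h2
    -- Polarization with `‖c i - c₀‖ = R - r i`: since `(1 - a)² + (1 - b)² - max(a, b)² + min(a,
    -- b)² = 2 (1 - a - b + min(a, b)²)`, only the error `η + η²/2` times the larger squared radius
    -- remains.
    have hterm : ∀ j, w j * (R ^ 2 * (1 - x i + (min (x i) (x j) ^ 2 - x j) -
        (η + η ^ 2 / 2) * N ^ 2)) ≤ w j * inner ℝ (c i - c₀) (c j - c₀) := by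
      intro j
      by_cases hj : w j = 0
      · simp [hj]
      refine mul_le_mul_of_nonneg_left ?_ (hw j)
      have hi1 : ‖c i - c₀‖ = R - R * x i := by
        have := hwT i hi
        rw [dist_eq_norm, hrx] at this
        linarith
      have hj1 : ‖c j - c₀‖ = R - R * x j := by
        have := hwT j hj
        rw [dist_eq_norm, hrx] at this
        linarith
      have hp := hpair i j
      have e1 : c i - c j = (c i - c₀) - (c j - c₀) := by abel
      rw [dist_eq_norm, e1, norm_sub_sq_real, hi1, hj1, hrx i, hrx j] at hp
      have hη0 : 0 ≤ η + η ^ 2 / 2 := by positivity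
      rcases le_total (x i) (x j) with h | h
      · have h' := mul_le_mul_of_nonneg_left h hRpos.le
        rw [min_eq_left h', max_eq_right h'] at hp
        rw [min_eq_left h]
        have hsq : x j ^ 2 ≤ N ^ 2 := pow_le_pow_left₀ (hx0 j) (hxN j) 2
        have h3 := mul_le_mul_of_nonneg_left hsq (mul_nonneg (sq_nonneg R) hη0)
        linarith
      · have h' := mul_le_mul_of_nonneg_left h hRpos.le
        rw [min_eq_right h', max_eq_left h'] at hp
        rw [min_eq_right h]
        have hsq : x i ^ 2 ≤ N ^ 2 := pow_le_pow_left₀ (hx0 i) (hxN i) 2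
        have h3 := mul_le_mul_of_nonneg_left hsq (mul_nonneg (sq_nonneg R) hη0)
        linarith
    have hs := Finset.sum_le_sum fun j (_ : j ∈ Finset.univ) => hterm j
    rw [hzero] at hs
    have e2 : ∑ j, w j * (R ^ 2 * (1 - x i + (min (x i) (x j) ^ 2 - x j) -
        (η + η ^ 2 / 2) * N ^ 2)) = R ^ 2 * (1 - x i + ∑ j, w j * (min (x i) (x j) ^ 2 - x j) -
        (η + η ^ 2 / 2) * N ^ 2) := by
      have : ∀ j, w j * (R ^ 2 * (1 - x i + (min (x i) (x j) ^ 2 - x j) -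
          (η + η ^ 2 / 2) * N ^ 2)) = w j * (R ^ 2 * (1 - x i - (η + η ^ 2 / 2) * N ^ 2)) +
          R ^ 2 * (w j * (min (x i) (x j) ^ 2 - x j)) := fun j => by ring
      simp_rw [this, Finset.sum_add_distrib, ← Finset.sum_mul, ← Finset.mul_sum, hw1]
      ring
    rw [e2] at hs
    have := nonpos_of_mul_nonpos_right hs (by positivity)
    linarith
  have h1 := quarter_sub_log_le hw hw1 hxN hN2 fun t ht _ => one_sub_add_sum_le hw hw1 hf ht
  exact absurd h1 (not_le.2 (log_expansion_bound hδ0 hδ1))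

end GuardedBallCover

/-! ### The invariant of the algorithm. -/

namespace GuardedBallCover

/-- The relation between a stored ball `A` and a stored ball `B` that was added earlier. -/
def Nested {d : ℕ} (ε : ℝ) (A B : GuardedBall d) : Prop :=
  0 < A.radius ∧ (1 + ε ^ 2 / 5) * B.radius ≤ A.radius ∧
    dist A.center B.center ^ 2 + B.radius ^ 2 ≤ ((1 + ε ^ 2 / 40) * A.radius) ^ 2

/-- The invariant of the algorithm: `S` is the set of points processed so far, `h` the ball that
was added last. -/
structure CoverInvariant {d : ℕ} (ε : ℝ) (S : Set (Pt d)) (M : Memory d) (h : GuardedBall d) :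
    Prop where
  head : ∃ t, M.balls = h :: t
  first_mem : M.first ∈ S
  -- `K` is the coreset, with the new point, from which `B` was computed. Some of its guards may
  -- since have been deleted; those are close to `p₁`.
  witness : ∀ B ∈ M.balls, ∃ K : Set (Pt d), IsMEB K B.toBall ∧ M.first ∈ K ∧ B.guard ∈ K ∧
    K ⊆ S ∧ ∀ x ∈ K, x ∈ M.coreset ∨ dist x M.first ≤ ε ^ 2 / 40 * h.radius
  pairwise : M.balls.Pairwise (Nested ε)
  large : ∀ B ∈ M.balls, ε ^ 2 * h.radius / 80 ≤ B.radius
  covered : ∀ x ∈ S, M.Covers ε x ∨ dist x M.first ≤ ε ^ 2 / 20 * h.radius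

namespace CoverInvariant

variable {d : ℕ} {ε : ℝ} {S : Set (Pt d)} {M : Memory d} {h : GuardedBall d}

theorem head_mem (H : CoverInvariant ε S M h) : h ∈ M.balls := by
  obtain ⟨t, ht⟩ := H.head
  simp [ht]

theorem radius_nonneg (H : CoverInvariant ε S M h) {B : GuardedBall d} (hB : B ∈ M.balls) :
    0 ≤ B.radius := by
  obtain ⟨K, hK, -⟩ := H.witness B hB
  exact hK.1

theorem radius_le_head (H : CoverInvariant ε S M h) {B : GuardedBall d}
    (hB : B ∈ M.balls) : B.radius ≤ h.radius := by
  obtain ⟨t, ht⟩ := H.head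
  have hnn := H.radius_nonneg hB
  have hp := H.pairwise
  rw [ht] at hp hB
  rcases List.mem_cons.1 hB with rfl | hB
  · exact le_rfl
  · have := (List.rel_of_pairwise_cons hp hB).2.1
    nlinarith [sq_nonneg ε]

theorem dist_center_first_le (H : CoverInvariant ε S M h) {B : GuardedBall d}
    (hB : B ∈ M.balls) : dist B.center M.first ≤ B.radius := by
  obtain ⟨K, hK, hf, -⟩ := H.witness B hB
  rw [dist_comm]
  exact Metric.mem_closedBall.1 (hK.2.1 hf)

theorem dist_guard_first_le (H : CoverInvariant ε S M h) {B : GuardedBall d}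
    (hB : B ∈ M.balls) : dist B.guard M.first ≤ 2 * B.radius := by
  obtain ⟨K, hK, -, hg, -⟩ := H.witness B hB
  have h1 := H.dist_center_first_le hB
  have h2 : dist B.guard B.center ≤ B.radius := Metric.mem_closedBall.1 (hK.2.1 hg)
  linarith [dist_triangle B.guard B.center M.first]

theorem coreset_subset (H : CoverInvariant ε S M h) : M.coreset ⊆ S := by
  rintro x (rfl | ⟨B, hB, rfl⟩)
  · exact H.first_mem
  · obtain ⟨K, -, -, hg, hS, -⟩ := H.witness B hB
    exact hS hg

theorem covers_first (H : CoverInvariant ε S M h) (hε : 0 < ε) : M.Covers ε M.first := by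
  refine ⟨h, H.head_mem, ?_⟩
  have h1 := H.dist_center_first_le H.head_mem
  have h2 := H.radius_nonneg H.head_mem
  simp only [Ball.toSet, Ball.expand, Metric.mem_closedBall]
  rw [dist_comm]
  nlinarith

theorem dist_le_of_mem_expand (H : CoverInvariant ε S M h) (hε : ε ≤ 1) {B : GuardedBall d}
    (hB : B ∈ M.balls) {x : Pt d} (hx : x ∈ (B.toBall.expand (1 + ε)).toSet) :
    dist x M.first ≤ 3 * B.radius := by
  have h1 := H.dist_center_first_le hB
  have h2 := H.radius_nonneg hB
  have h3 : dist x B.center ≤ (1 + ε) * B.radius := Metric.mem_closedBall.1 hx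
  have h4 := dist_triangle x B.center M.first
  nlinarith

end CoverInvariant

theorem isMEB_singleton {d : ℕ} (p : Pt d) : IsMEB {p} ⟨p, 0⟩ :=
  ⟨le_rfl, by simp [Ball.toSet], fun _ h _ => h⟩

theorem coverInvariant_start {d : ℕ} {ε : ℝ} (p : Pt d) :
    CoverInvariant ε {p} (start p) ⟨⟨p, 0⟩, p⟩ where
  head := ⟨[], rfl⟩
  first_mem := rfl
  witness := by
    intro B hB
    simp only [start, List.mem_singleton] at hB
    subst hB
    refine ⟨{p}, isMEB_singleton p, rfl, rfl, subset_rfl, ?_⟩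
    rintro x rfl
    exact Or.inl (Set.mem_insert _ _)
  pairwise := by simp [start]
  large := by
    intro B hB
    simp only [start, List.mem_singleton] at hB
    subst hB
    simp
  covered := by
    rintro x rfl
    right
    simp [start]

/-- Growth of the radius when a point outside the expansion of a ball arrives. -/
theorem radius_growth {ε r r' x y : ℝ} (hε0 : 0 < ε) (hε1 : ε ≤ 1) (hr : 0 ≤ r) (hr' : 0 ≤ r')
    (h1 : x ^ 2 + r ^ 2 ≤ (r' + ε ^ 2 / 40 * r) ^ 2) (h2 : (1 + ε) * r < y) (h3 : y ≤ x + r') :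
    (1 + ε ^ 2 / 5) * r ≤ r' := by
  -- If `r'` were smaller, the centers would be more than `(3/4) ε r` apart, whereas `h1` allows at
  -- most `x² ≤ ((1 + ε²/4)² - 1) r² ≤ (9/16) ε² r²`.
  rcases hr.eq_or_lt with rfl | hr
  · simpa using hr'
  by_contra! hlt
  have hsq : ε ^ 2 ≤ ε := by nlinarith
  have ha : r' + ε ^ 2 / 40 * r ≤ (1 + ε ^ 2 / 4) * r := by nlinarith [sq_nonneg ε]
  have h5 : (r' + ε ^ 2 / 40 * r) ^ 2 ≤ ((1 + ε ^ 2 / 4) * r) ^ 2 :=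
    pow_le_pow_left₀ (by positivity) ha 2
  have h8 : (3 / 4 * ε * r) ^ 2 < x ^ 2 := by
    refine pow_lt_pow_left₀ ?_ (by positivity) two_ne_zero
    nlinarith
  have h9 : (9 / 16 * ε ^ 2 + 1) * r ^ 2 < (1 + ε ^ 2 / 4) ^ 2 * r ^ 2 := by linarith
  have h10 : 9 / 16 * ε ^ 2 + 1 < (1 + ε ^ 2 / 4) ^ 2 := lt_of_mul_lt_mul_right h9 (by positivity)
  have : ε ^ 2 * ε ^ 2 ≤ ε ^ 2 := by nlinarith
  nlinarith

/-- A ball deleted on the arrival of a ball of radius `r` has radius below `ε²r/80`. Its guard is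
within twice that of `p₁`, and its expansion within three times that, which fits the bounds `ε²r/40`
and `ε²r/20`. These bounds only loosen as `r` grows, so errors do not accumulate. -/
theorem CoverInvariant.exists_process {d : ℕ} {ε : ℝ} {S : Set (Pt d)} {M : Memory d}
    {h : GuardedBall d} (hε0 : 0 < ε) (hε1 : ε ≤ 1) (hS : S.Finite)
    (H : CoverInvariant ε S M h) (p : Pt d) :
    ∃ h', CoverInvariant ε (insert p S) (process ε M p) h' := by
  by_cases hp : M.Covers ε p
  · refine ⟨h, ?_⟩
    rw [process, if_pos hp]
    refine ⟨H.head, Or.inr H.first_mem, fun B hB => ?_, H.pairwise, H.large, ?_⟩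
    · obtain ⟨K, h1, h2, h3, h4, h5⟩ := H.witness B hB
      exact ⟨K, h1, h2, h3, h4.trans (Set.subset_insert _ _), h5⟩
    · rintro x (rfl | hx)
      · exact Or.inl hp
      · exact H.covered x hx
  set A : Ball d := meb (M.coreset ∪ {p}) with hA
  set M' := process ε M p with hM'
  have hproc : M' = ⟨M.first, ⟨A, p⟩ ::
      M.balls.filter fun B' => decide (ε ^ 2 * A.radius / 80 ≤ B'.radius)⟩ := by
    rw [hM', process, if_neg hp]
  have hKS : M.coreset ∪ {p} ⊆ insert p S := by
    rintro x (hx | rfl)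
    · exact Or.inr (H.coreset_subset hx)
    · exact Or.inl rfl
  have hfirst : M.first ∈ M.coreset := Set.mem_insert _ _
  have hAmeb : IsMEB (M.coreset ∪ {p}) A := isMEB_meb _ ((hS.insert p).subset hKS).isBounded
  have hAsub : ∀ x ∈ M.coreset, dist x A.center ≤ A.radius := fun x hx =>
    Metric.mem_closedBall.1 (hAmeb.2.1 (Or.inl hx))
  have hpA : dist p A.center ≤ A.radius := Metric.mem_closedBall.1 (hAmeb.2.1 (Or.inr rfl))
  -- A zero radius would give `p = p₁`, which is always covered.
  have hApos : 0 < A.radius := by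
    by_contra hle
    have h1 := hAsub _ hfirst
    have h2 : M.first = A.center := dist_le_zero.1 (by linarith)
    have h3 : p = A.center := dist_le_zero.1 (by linarith)
    exact hp (h3 ▸ h2 ▸ H.covers_first hε0)
  have hε2 : 0 < ε ^ 2 := by positivity
  have hh0 := H.radius_nonneg H.head_mem
  have hsub : ∀ B ∈ M.balls, dist A.center B.center ^ 2 + B.radius ^ 2 ≤
      (A.radius + ε ^ 2 / 40 * h.radius) ^ 2 := by
    intro B hB
    obtain ⟨K, h1, h2, h3, h4, h5⟩ := H.witness B hB
    rw [dist_comm]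
    refine h1.dist_sq_add_sq_le ⟨_, h2⟩ fun x hx => Metric.mem_closedBall.2 ?_
    rcases h5 x hx with hx | hx
    · have := hAsub x hx
      have : 0 ≤ ε ^ 2 / 40 * h.radius := by positivity
      linarith
    · have := hAsub _ hfirst
      linarith [dist_triangle x M.first A.center]
  have hgrow : (1 + ε ^ 2 / 5) * h.radius ≤ A.radius := by
    have hout : (1 + ε) * h.radius < dist p h.center := by
      by_contra hle
      exact hp ⟨h, H.head_mem, Metric.mem_closedBall.2 (not_lt.1 hle)⟩
    refine radius_growth hε0 hε1 hh0 hApos.le (hsub h H.head_mem) hout ?_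
    have := dist_triangle p A.center h.center
    linarith
  have hhA : h.radius ≤ A.radius := by nlinarith
  have hnear : ∀ x, x ∈ M.coreset ∨ dist x M.first ≤ ε ^ 2 / 40 * h.radius →
      x ∈ M'.coreset ∨ dist x M.first ≤ ε ^ 2 / 40 * A.radius := by
    rintro x ((rfl | ⟨B, hB, rfl⟩) | hx)
    · left
      rw [hproc]
      exact Set.mem_insert _ _
    · by_cases hk : ε ^ 2 * A.radius / 80 ≤ B.radius
      · left
        rw [hproc]
        exact Or.inr ⟨B, List.mem_cons_of_mem _ (List.mem_filter.2 ⟨hB, by simpa using hk⟩), rfl⟩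
      · right
        have := H.dist_guard_first_le hB
        linarith
    · right
      have : ε ^ 2 / 40 * h.radius ≤ ε ^ 2 / 40 * A.radius := by gcongr
      linarith
  refine ⟨⟨A, p⟩, ?_⟩
  have hfst : M'.first = M.first := by rw [hproc]
  have hballs : M'.balls = ⟨A, p⟩ ::
      M.balls.filter fun B' => decide (ε ^ 2 * A.radius / 80 ≤ B'.radius) := by rw [hproc]
  have hmem : ∀ B, B ∈ M'.balls ↔
      B = ⟨A, p⟩ ∨ (B ∈ M.balls ∧ ε ^ 2 * A.radius / 80 ≤ B.radius) := fun B => by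
    rw [hballs]
    simp
  refine ⟨⟨_, hballs⟩, ?_, ?_, ?_, ?_, ?_⟩
  · rw [hfst]
    exact Or.inr H.first_mem
  · intro B hB
    rw [hfst]
    rcases (hmem B).1 hB with rfl | ⟨hB, hk⟩
    · refine ⟨_, hAmeb, Or.inl hfirst, Or.inr rfl, hKS, ?_⟩
      rintro x (hx | hx)
      · exact hnear x (Or.inl hx)
      · left
        exact Or.inr ⟨_, hB, hx.symm⟩
    · obtain ⟨K, h1, h2, h3, h4, h5⟩ := H.witness B hB
      exact ⟨K, h1, h2, h3, h4.trans (Set.subset_insert _ _), fun x hx => hnear x (h5 x hx)⟩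
  · rw [hballs]
    refine List.pairwise_cons.2 ⟨fun B hB => ?_, H.pairwise.filter _⟩
    have hB' := (List.mem_filter.1 hB).1
    refine ⟨hApos, ?_, (hsub B hB').trans ?_⟩
    · have := mul_le_mul_of_nonneg_left (H.radius_le_head hB') (by positivity : 0 ≤ 1 + ε ^ 2 / 5)
      exact this.trans hgrow
    · have : ε ^ 2 / 40 * h.radius ≤ ε ^ 2 / 40 * A.radius := by gcongr
      refine pow_le_pow_left₀ (by positivity) ?_ 2
      simp only
      linarith
  · intro B hB
    rcases (hmem B).1 hB with rfl | ⟨hB, hk⟩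
    · have : ε ^ 2 * A.radius ≤ 1 * A.radius := by
        gcongr
        exact pow_le_one₀ hε0.le hε1
      simp only
      linarith
    · exact hk
  · intro x hx
    rw [hfst]
    rcases hx with rfl | hx
    · left
      refine ⟨⟨A, x⟩, (hmem _).2 (Or.inl rfl), Metric.mem_closedBall.2 ?_⟩
      simp only [Ball.expand]
      nlinarith
    · rcases H.covered x hx with ⟨B, hB, hxB⟩ | hx
      · by_cases hk : ε ^ 2 * A.radius / 80 ≤ B.radius
        · exact Or.inl ⟨B, (hmem B).2 (Or.inr ⟨hB, hk⟩), hxB⟩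
        · right
          have := H.dist_le_of_mem_expand hε1 hB hxB
          simp only
          nlinarith
      · right
        have : ε ^ 2 / 20 * h.radius ≤ ε ^ 2 / 20 * A.radius := by gcongr
        exact hx.trans this

theorem points_finite {d : ℕ} (p₁ : Pt d) (s : List (Pt d)) : (points p₁ s).Finite :=
  (p₁ :: s).finite_toSet

theorem points_append {d : ℕ} (p₁ p : Pt d) (s : List (Pt d)) :
    points p₁ (s ++ [p]) = insert p (points p₁ s) := by
  ext x
  simp only [points, Set.mem_ofPred_eq, Set.mem_insert_iff, List.mem_cons, List.mem_append,
    List.not_mem_nil, or_false]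
  tauto

theorem exists_coverInvariant {d : ℕ} {ε : ℝ} (hε0 : 0 < ε) (hε1 : ε ≤ 1) (p₁ : Pt d)
    (s : List (Pt d)) : ∃ h, CoverInvariant ε (points p₁ s) (cover ε p₁ s) h := by
  induction s using List.reverseRecOn with
  | nil =>
    have : points p₁ [] = {p₁} := by ext x; simp [points]
    rw [this]
    exact ⟨_, coverInvariant_start p₁⟩
  | append_singleton s p ih =>
    obtain ⟨h, H⟩ := ih
    rw [points_append, cover, List.foldl_append]
    exact H.exists_process hε0 hε1 (points_finite p₁ s) p

end GuardedBallCover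

/-! ### Size, covering and radius from the invariant. -/

namespace GuardedBallCover

theorem pow_length_mul_le {α : Type*} {ρ : α → ℝ} {P : α → α → Prop} {g m : ℝ} (hg : 0 ≤ g)
    (hP : ∀ a b, P a b → g * ρ b ≤ ρ a) :
    ∀ (l : List α) (a : α), (a :: l).Pairwise P → (∀ b ∈ a :: l, m ≤ ρ b) →
      g ^ l.length * m ≤ ρ a := by
  intro l
  induction l with
  | nil =>
    intro a _ h
    simpa using h a (by simp)
  | cons b l ih =>
    intro a hp h
    have h1 := ih b hp.of_cons fun c hc => h c (List.mem_cons_of_mem _ hc)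
    have h2 := hP a b (List.rel_of_pairwise_cons hp (by simp))
    calc g ^ (b :: l).length * m = g * (g ^ l.length * m) := by
          rw [List.length_cons, pow_succ]
          ring
      _ ≤ g * ρ b := mul_le_mul_of_nonneg_left h1 hg
      _ ≤ ρ a := h2

theorem log_le_of_le_pow {a b : ℝ} (n : ℕ) (ha : 0 < a) (h : a ≤ b ^ n) :
    Real.log a ≤ n * Real.log b := by
  rw [← Real.log_pow]
  exact Real.log_le_log ha h

theorem Memory.isBounded_union {d : ℕ} (M : Memory d) : Bornology.IsBounded M.union := by
  have e : M.union = ⋃ B ∈ {B | B ∈ M.balls}, B.toBall.toSet := by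
    ext x
    simp [Memory.union]
  rw [e, Bornology.isBounded_biUnion M.balls.finite_toSet]
  exact fun B _ => Metric.isBounded_closedBall

theorem IsMEB.radius_eq_zero {d : ℕ} [Subsingleton (Pt d)] {X : Set (Pt d)} {B : Ball d}
    (hB : IsMEB X B) : B.radius = 0 :=
  le_antisymm (hB.2.2 ⟨B.center, 0⟩ le_rfl fun x _ => by
    simp [Ball.toSet, Subsingleton.elim x B.center]) hB.1

namespace CoverInvariant

variable {d : ℕ} {ε : ℝ} {S : Set (Pt d)} {M : Memory d} {h : GuardedBall d}

/-- The stored radii lie between `ε² h.radius / 80` and `h.radius` and grow geometrically, so there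
are at most `1 + log(80/ε²) / log(1 + ε²/5)` balls. -/
theorem numPoints_le (hε0 : 0 < ε) (hε1 : ε ≤ 1) (H : CoverInvariant ε S M h) :
    (M.numPoints : ℝ) ≤ 3 + 84 * ((1 / ε) ^ 2 * Real.log (2 / ε)) := by
  obtain ⟨t, ht⟩ := H.head
  suffices hlen : (t.length : ℝ) ≤ 42 * ((1 / ε) ^ 2 * Real.log (2 / ε)) by
    rw [Memory.numPoints, ht, List.length_cons]
    push_cast
    linarith
  have hlog : 0 ≤ Real.log (2 / ε) := Real.log_nonneg (by rw [le_div_iff₀ hε0]; linarith)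
  -- The initial ball has radius `0`; division by `h.radius` is possible only once an older ball is
  -- present.
  rcases t.eq_nil_or_concat with rfl | ⟨t', b, rfl⟩
  · simp only [List.length_nil, Nat.cast_zero]
    positivity
  have hpos : 0 < h.radius := by
    have hp := H.pairwise
    rw [ht] at hp
    exact (List.rel_of_pairwise_cons hp (a' := b) (by simp)).1
  generalize t'.concat b = t at ht ⊢
  have hp := H.pairwise
  have hl := H.large
  rw [ht] at hp hl
  have hpow := pow_length_mul_le (ρ := fun B : GuardedBall d => B.radius) (P := Nested ε)
    (by positivity : 0 ≤ 1 + ε ^ 2 / 5) (fun A B hAB => hAB.2.1) t h hp hl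
  have hle : (1 + ε ^ 2 / 5) ^ t.length ≤ 80 / ε ^ 2 := by
    rw [le_div_iff₀ (by positivity)]
    have e : (1 + ε ^ 2 / 5) ^ t.length * ε ^ 2 * h.radius ≤ 80 * h.radius := by
      linarith
    exact le_of_mul_le_mul_right e hpos
  have h1 : t.length * Real.log (1 + ε ^ 2 / 5) ≤ Real.log (80 / ε ^ 2) := by
    rw [← Real.log_pow]
    exact Real.log_le_log (by positivity) hle
  have h2 : ε ^ 2 / 6 ≤ Real.log (1 + ε ^ 2 / 5) := by
    refine le_trans ?_ (Real.one_sub_inv_le_log_of_pos (by positivity))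
    have e : 1 - (1 + ε ^ 2 / 5)⁻¹ = ε ^ 2 / (5 + ε ^ 2) := by
      field_simp
      ring
    rw [e]
    have := pow_le_one₀ (n := 2) hε0.le hε1
    gcongr
    linarith
  -- `80 ≤ 2⁷`; with the `1/6` from `h2` this gives `42 = 6 · 7`.
  have h3 : Real.log (80 / ε ^ 2) ≤ (7 : ℕ) * Real.log (2 / ε) := by
    refine log_le_of_le_pow 7 (by positivity) ?_
    rw [div_pow]
    exact div_le_div₀ (by norm_num) (by norm_num) (by positivity)
      (pow_le_pow_of_le_one hε0.le hε1 (by norm_num))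
  have h4 : t.length * (ε ^ 2 / 6) ≤ 7 * Real.log (2 / ε) := by
    have := mul_le_mul_of_nonneg_left h2 (Nat.cast_nonneg (α := ℝ) t.length)
    push_cast at h3
    linarith
  have e : 42 * ((1 / ε) ^ 2 * Real.log (2 / ε)) = 42 * Real.log (2 / ε) / ε ^ 2 := by
    field_simp
  rw [e, le_div_iff₀ (by positivity)]
  linarith

theorem dist_add_radius_le (H : CoverInvariant ε S M h) {B : GuardedBall d} (hB : B ∈ M.balls)
    {B' : Ball d} (hB' : IsMEB M.union B') :
    dist B.center B'.center + B.radius ≤ B'.radius := by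
  -- In dimension `0` inclusion of balls says nothing about radii, but there all minimum enclosing
  -- balls have radius `0`.
  rcases subsingleton_or_nontrivial (Pt d) with _ | _
  · obtain ⟨K, hK, -⟩ := H.witness B hB
    rw [Subsingleton.elim B.center B'.center, dist_self, hK.radius_eq_zero,
      hB'.radius_eq_zero, add_zero]
  · exact dist_add_le_of_closedBall_subset (H.radius_nonneg hB)
      fun x hx => hB'.2.1 ⟨B, hB, hx⟩

theorem subset_expand (hε0 : 0 < ε) (hε1 : ε ≤ 1) (H : CoverInvariant ε S M h) {B' : Ball d}
    (hB' : IsMEB M.union B') : S ⊆ (B'.expand (1 + ε)).toSet := by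
  intro x hx
  refine Metric.mem_closedBall.2 ?_
  simp only [Ball.expand]
  rcases H.covered x hx with ⟨B, hB, hxB⟩ | hx
  · have h1 := H.dist_add_radius_le hB hB'
    have h2 : dist x B.center ≤ (1 + ε) * B.radius := Metric.mem_closedBall.1 hxB
    have h3 := dist_triangle x B.center B'.center
    have h4 : ε * B.radius ≤ ε * B'.radius := by
      have := dist_nonneg (x := B.center) (y := B'.center)
      gcongr
      linarith
    linarith
  · have h1 := H.dist_add_radius_le H.head_mem hB'
    have h2 := H.dist_center_first_le H.head_mem
    have h3 := dist_triangle x M.first B'.center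
    have h4 := dist_triangle M.first h.center B'.center
    rw [dist_comm M.first h.center] at h4
    have h5 : ε ^ 2 / 20 * h.radius ≤ ε * B'.radius := by
      have := dist_nonneg (x := h.center) (y := B'.center)
      have := H.radius_nonneg H.head_mem
      have : ε ^ 2 / 20 ≤ ε := by nlinarith
      gcongr
      linarith
    linarith

theorem dist_sq_add_min_sq_le (H : CoverInvariant ε S M h) {A B : GuardedBall d}
    (hA : A ∈ M.balls) (hB : B ∈ M.balls) :
    dist A.center B.center ^ 2 + min A.radius B.radius ^ 2 ≤
      ((1 + ε ^ 2 / 40) * max A.radius B.radius) ^ 2 := by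
  have hle : ∀ {A B : GuardedBall d}, A ∈ M.balls → B ∈ M.balls → Nested ε A B →
      B.radius ≤ A.radius := fun {A B} _ hB hAB => by
    have := H.radius_nonneg hB
    nlinarith [hAB.2.1, sq_nonneg ε]
  have hp : M.balls.Pairwise fun A B => dist A.center B.center ^ 2 + min A.radius B.radius ^ 2 ≤
      ((1 + ε ^ 2 / 40) * max A.radius B.radius) ^ 2 := by
    refine List.Pairwise.imp_of_mem (fun {A B} hA hB hAB => ?_) H.pairwise
    rw [min_eq_right (hle hA hB hAB), max_eq_left (hle hA hB hAB)]
    exact hAB.2.2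
  have hsymm : Std.Symm fun A B : GuardedBall d =>
      dist A.center B.center ^ 2 + min A.radius B.radius ^ 2 ≤
        ((1 + ε ^ 2 / 40) * max A.radius B.radius) ^ 2 :=
    ⟨fun A B hAB => by rwa [dist_comm, min_comm, max_comm]⟩
  refine List.Pairwise.forall_of_forall (fun A hA => ?_) hp hA hB
  have := H.radius_nonneg hA
  rw [dist_self, min_self, max_self, zero_pow two_ne_zero, zero_add]
  refine pow_le_pow_left₀ this ?_ 2
  nlinarith [sq_nonneg ε]

theorem radius_le (hε0 : 0 < ε) (hε1 : ε ≤ 1) (H : CoverInvariant ε S M h) {B' B : Ball d}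
    (hB' : IsMEB M.union B') (hB : IsMEB S B) : B'.radius ≤ (1.22 + ε / 10) * B.radius := by
  obtain ⟨t, ht⟩ := H.head
  have hne : Nonempty (Fin M.balls.length) := ⟨⟨0, by simp [ht]⟩⟩
  refine radius_le_of_nested (c := fun i : Fin M.balls.length => (M.balls.get i).center)
    (r := fun i => (M.balls.get i).radius) (c₀ := B'.center) hε0 hε1
    (fun i => H.radius_nonneg (List.get_mem _ _)) (fun i => ?_)
    (fun i j => H.dist_sq_add_min_sq_le (List.get_mem _ _) (List.get_mem _ _))
    (fun i => H.dist_add_radius_le (List.get_mem _ _) hB') (fun c' R' hR' => ?_)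
  · obtain ⟨K, hK, -, -, hKS, -⟩ := H.witness _ (List.get_mem M.balls i)
    exact hK.2.2 B hB.1 (hKS.trans hB.2.1)
  · have h0 : 0 ≤ R' := by
      have i : Fin M.balls.length := Classical.arbitrary _
      have h1 := H.radius_nonneg (List.get_mem M.balls i)
      have h2 := hR' i
      have h3 := dist_nonneg (x := (M.balls.get i).center) (y := c')
      linarith
    refine hB'.2.2 ⟨c', R'⟩ h0 ?_
    rintro x ⟨A, hA, hx⟩
    obtain ⟨i, rfl⟩ := List.get_of_mem hA
    have h1 : dist x (M.balls.get i).center ≤ (M.balls.get i).radius := Metric.mem_closedBall.1 hx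
    have h2 := hR' i
    refine Metric.mem_closedBall.2 ?_
    have h3 := dist_triangle x (M.balls.get i).center c'
    simp only
    linarith

end CoverInvariant

end GuardedBallCover

theorem mainTheorem3 :
    ∃ C : ℝ, 0 < C ∧
      ∀ (d : ℕ) (ε : ℝ), 0 < ε → ε ≤ 1 →
      ∀ (p₁ : GuardedBallCover.Pt d) (s : List (GuardedBallCover.Pt d)),
        -- the cover with parameter `ε`, and the ball `MEB` of the union of its balls
        (((GuardedBallCover.cover ε p₁ s).numPoints : ℝ) ≤ C * ((1 / ε) ^ 2 * Real.log (2 / ε)) ∧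
          (GuardedBallCover.meb (GuardedBallCover.cover ε p₁ s).union).radius ≤
            (1.22 + ε) * (GuardedBallCover.meb (GuardedBallCover.points p₁ s)).radius ∧
          GuardedBallCover.points p₁ s ⊆
            ((GuardedBallCover.meb (GuardedBallCover.cover ε p₁ s).union).expand (1 + ε)).toSet) ∧
        -- with parameter `ε / 4`, the expansion of this ball is a `(1.22 + ε)`-`MEB` of the stream
        (((GuardedBallCover.cover (ε / 4) p₁ s).numPoints : ℝ) ≤
            C * ((1 / ε) ^ 2 * Real.log (2 / ε)) ∧
          GuardedBallCover.IsApproxMEB (1.22 + ε) (GuardedBallCover.points p₁ s)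
            ((GuardedBallCover.meb (GuardedBallCover.cover (ε / 4) p₁ s).union).expand
              (1 + ε / 4))) := by
  -- Replacing `ε` by `ε/4` costs a factor `16 · 3 = 48`, so the count is at most `3 + 84 · 48 L`
  -- with `L = ε⁻² log(2/ε) ≥ 0.69`.
  refine ⟨4100, by norm_num, fun d ε hε0 hε1 p₁ s => ?_⟩
  have hfin := GuardedBallCover.points_finite p₁ s
  have hS := GuardedBallCover.isMEB_meb _ hfin.isBounded
  have hlog2 : 0.69 ≤ Real.log (2 / ε) := by
    have h1 : Real.log 2 ≤ Real.log (2 / ε) := by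
      refine Real.log_le_log (by norm_num) ?_
      rw [le_div_iff₀ hε0]
      linarith
    have := Real.log_two_gt_d9
    norm_num at *
    linarith
  have hinv : 1 ≤ (1 / ε) ^ 2 := one_le_pow₀ (by rw [le_div_iff₀ hε0]; linarith)
  have hL : 0.69 ≤ (1 / ε) ^ 2 * Real.log (2 / ε) := by
    have := mul_le_mul hinv hlog2 (by norm_num) (by positivity)
    linarith
  have hε4 : 0 < ε / 4 := by positivity
  have hε41 : ε / 4 ≤ 1 := by linarith
  obtain ⟨h, H⟩ := GuardedBallCover.exists_coverInvariant hε0 hε1 p₁ s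
  obtain ⟨h', H'⟩ := GuardedBallCover.exists_coverInvariant hε4 hε41 p₁ s
  have hU := GuardedBallCover.isMEB_meb _ (GuardedBallCover.Memory.isBounded_union
    (GuardedBallCover.cover ε p₁ s))
  have hU' := GuardedBallCover.isMEB_meb _ (GuardedBallCover.Memory.isBounded_union
    (GuardedBallCover.cover (ε / 4) p₁ s))
  refine ⟨⟨?_, ?_, H.subset_expand hε0 hε1 hU⟩, ?_, H'.subset_expand hε4 hε41 hU', ?_⟩
  · have := H.numPoints_le hε0 hε1
    norm_num at *
    linarith
  · refine (H.radius_le hε0 hε1 hU hS).trans (mul_le_mul_of_nonneg_right ?_ hS.1)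
    linarith
  · have h1 := H'.numPoints_le hε4 hε41
    have h2 : Real.log (2 / (ε / 4)) ≤ (3 : ℕ) * Real.log (2 / ε) := by
      refine GuardedBallCover.log_le_of_le_pow 3 (by positivity) ?_
      have e : 2 / (ε / 4) = 2 ^ 3 / ε := by
        field_simp
        norm_num
      rw [e, div_pow]
      gcongr
      exact pow_le_of_le_one hε0.le hε1 (by norm_num)
    have h3 : (1 / (ε / 4)) ^ 2 * Real.log (2 / (ε / 4)) ≤
        48 * ((1 / ε) ^ 2 * Real.log (2 / ε)) := by
      have e : (1 / (ε / 4)) ^ 2 = 16 * (1 / ε) ^ 2 := by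
        field_simp
        norm_num
      rw [e]
      have := mul_le_mul_of_nonneg_left h2 (by positivity : 0 ≤ 16 * (1 / ε) ^ 2)
      push_cast at this
      linarith
    norm_num at *
    linarith
  · have h1 := H'.radius_le hε4 hε41 hU' hS
    simp only [GuardedBallCover.Ball.expand]
    have h2 := mul_le_mul_of_nonneg_left h1 (by positivity : 0 ≤ 1 + ε / 4)
    refine h2.trans ?_
    rw [← mul_assoc]
    refine mul_le_mul_of_nonneg_right ?_ hS.1
    -- `(1 + ε/4)(1.22 + ε/40) ≤ 1.22 + ε`; this uses the sharper excess `δ/10`, at `δ = ε/4`, in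
    -- `radius_le`.
    nlinarith
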